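/- Let $N$ be a natural number. A (concurrent) min-cost reachability game with players $1,\dots,N$ consists of a finite set $V$ of vertices, a set $T\subseteq V$ of targets, a finite nonempty set $A_i$ of actions for each player $i$, a set $E\subseteq V\times V$ of directed edges, a map $\mathrm{Next}\colon V\times\prod_i A_i\to V$ with $(v,\mathrm{Next}(v,\vec a))\in E$ for all $v$ and $\vec a$, and for each player $i$ a weight function $w_i\colon E\to\mathbb{Z}$. The game is turn-based if for every vertex $v$ there is a player $i$ such that $\mathrm{Next}(v,\vec a)=\mathrm{Next}(v,\vec a')$ whenever $a_i=a_i'$. A finite play is a sequence $v_0\cdots v_k$ ($k\ge 0$) of vertices, starting in any vertex, with $(v_\ell,v_{\ell+1})\in E$ for all $0\le\ell<k$; its total payoff for player $i$ is $\mathrm{TP}_i(v_0\cdots v_k)=\sum_{\ell=0}^{k-1}w_i(v_\ell,v_{\ell+1})$. The cost $\mathrm{Cost}_i(\pi)$ for player $i$ of an infinite play $\pi=v_0v_1\cdots$ is $+\infty$ if $\pi$ visits no target, and $\mathrm{TP}_i(v_0\cdots v_\ell)$ otherwise, where $\ell$ is the least index with $v_\ell\in T$. A strategy of player $i$ is a map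 $\sigma_i\colon V^+\to A_i$, where $V^+$ is the set of nonempty finite sequences of vertices. The outcome of a strategy profile $\vec\sigma=(\sigma_1,\dots,\sigma_N)$ from a vertex $v$ is the infinite play with $v_0=v$ and $v_{\ell+1}=\mathrm{Next}\bigl(v_\ell,(\sigma_i(v_0\cdots v_\ell))_i\bigr)$ for all $\ell\ge 0$. A profile $\vec\sigma$ is a pure Nash equilibrium from $v$ if, for every player $i$, replacing $\sigma_i$ by any other strategy of player $i$ does not decrease $\mathrm{Cost}_i$ of the outcome from $v$. **Theorem.** Let $G$ be a turn-based min-cost reachability game such that for every player $i$ there exists $b_i\in\mathbb{N}$ such that every finite play $\rho$ satisfies $\mathrm{TP}_i(\rho)\ge -b_i$. Then for every vertex $v$ of $G$ there exists a pure Nash equilibrium from $v$ in $G$. -/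

import Mathlib

universe u v

/-- Nonempty finite sequences `v₀ v₁ ⋯ vₖ` of elements of `V`, in this order. -/
abbrev NonemptySeq (V : Type u) : Type u := {l : List V // l ≠ []}

/-- The last element `vₖ` of a nonempty finite sequence `v₀ ⋯ vₖ`. -/
def NonemptySeq.last {V : Type u} (h : NonemptySeq V) : V := h.1.getLast h.2

/-- The prefix `π[k] = π₀ ⋯ πₖ` of an infinite sequence. -/
def seqPrefix {V : Type u} (π : ℕ → V) (k : ℕ) : NonemptySeq V :=
  ⟨(List.range (k + 1)).map π, by simp⟩

/-- The sum of `w vₗ vₗ₊₁` over the consecutive pairs of a finite sequence. -/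
def sumAlong {V : Type u} (w : V → V → ℤ) : List V → ℤ
  | [] => 0
  | [_] => 0
  | x :: y :: l => w x y + sumAlong w (y :: l)

/-- A concurrent min-cost reachability game with players `Fin N`, vertices `V` and action sets
`A i`. The weight functions are total for convenience; only their values on edges matter.
(The sets are required to be finite, and the action sets nonempty, where the game is used.) -/
structure MCRGame (N : ℕ) (V : Type u) (A : Fin N → Type v) where
  /-- the target vertices, common to all players -/
  target : Set V
  /-- the directed edges -/
  edge : V → V → Prop
  /-- the next vertex, given the actions chosen by all the players -/
  next : V → (∀ i, A i) → V
  next_edge : ∀ x a, edge x (next x a)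
  /-- the integer weight of an edge for each player -/
  weight : Fin N → V → V → ℤ

namespace MCRGame

variable {N : ℕ} {V : Type u} {A : Fin N → Type v}

/-- With nonempty action sets there are no deadlocks. -/
theorem exists_edge [∀ i, Nonempty (A i)] (G : MCRGame N V A) (x : V) : ∃ y, G.edge x y :=
  ⟨_, G.next_edge x (fun i => Classical.arbitrary (A i))⟩

/-- A finite play is a nonempty finite sequence of vertices whose consecutive pairs are edges.
It may start in any vertex. -/
def IsFinitePlay (G : MCRGame N V A) (ρ : NonemptySeq V) : Prop := ρ.1.IsChain G.edge

/-- The total payoff of a finite play for player `i`. -/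
def totalPayoff (G : MCRGame N V A) (i : Fin N) (ρ : NonemptySeq V) : ℤ :=
  sumAlong (G.weight i) ρ.1

open Classical in
/-- The cost for player `i` of an infinite sequence of vertices: `+∞` if it visits no target,
and otherwise the total payoff of its prefix up to the first visit of a target. -/
noncomputable def cost (G : MCRGame N V A) (i : Fin N) (π : ℕ → V) : WithTop ℤ :=
  if h : ∃ n, π n ∈ G.target then
    ((G.totalPayoff i (seqPrefix π (Nat.find h)) : ℤ) : WithTop ℤ)
  else ⊤

/-- A (pure) strategy of player `i`: a map from nonempty histories to actions of `i`. -/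
abbrev Strategy (V : Type u) (A : Fin N → Type v) (i : Fin N) : Type (max u v) :=
  NonemptySeq V → A i

/-- A profile of strategies. -/
abbrev Profile (V : Type u) (A : Fin N → Type v) : Type (max u v) :=
  ∀ i : Fin N, Strategy V A i

/-- The history `v₀ ⋯ vₙ` obtained after `n` rounds from `x` under the profile `σ`. -/
def history (G : MCRGame N V A) (x : V) (σ : Profile V A) : ℕ → NonemptySeq V
  | 0 => ⟨[x], by simp⟩
  | n + 1 =>
    ⟨(history G x σ n).1 ++
      [G.next (history G x σ n).last (fun i => σ i (history G x σ n))], by simp⟩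

/-- The outcome of the profile `σ` from `x`: the play with `v₀ = x` and
`vₙ₊₁ = next vₙ (σᵢ(v₀ ⋯ vₙ))ᵢ`. -/
def outcome (G : MCRGame N V A) (x : V) (σ : Profile V A) (n : ℕ) : V :=
  (G.history x σ n).last

theorem history_eq_seqPrefix (G : MCRGame N V A) (x : V) (σ : Profile V A) (n : ℕ) :
    G.history x σ n = seqPrefix (G.outcome x σ) n := by
  induction n with
  | zero => simp [history, seqPrefix, outcome, NonemptySeq.last]
  | succ n ih =>
    apply Subtype.ext
    have h : (seqPrefix (G.outcome x σ) (n + 1)).1 =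
        (seqPrefix (G.outcome x σ) n).1 ++ [G.outcome x σ (n + 1)] := by
      simp [seqPrefix, List.range_succ]
    rw [h, ← ih]
    simp [outcome, NonemptySeq.last, history]

theorem outcome_zero (G : MCRGame N V A) (x : V) (σ : Profile V A) : G.outcome x σ 0 = x := by
  simp [outcome, history, NonemptySeq.last]

theorem outcome_succ (G : MCRGame N V A) (x : V) (σ : Profile V A) (n : ℕ) :
    G.outcome x σ (n + 1) =
      G.next (G.outcome x σ n) (fun i => σ i (seqPrefix (G.outcome x σ) n)) := by
  rw [← history_eq_seqPrefix]
  simp [outcome, NonemptySeq.last, history]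

/-- `σ` is a (pure) Nash equilibrium from `x`: no player can lower their cost by unilaterally
changing their strategy. -/
def IsNashEquilibrium (G : MCRGame N V A) (x : V) (σ : Profile V A) : Prop :=
  ∀ (i : Fin N) (τ : Strategy V A i),
    G.cost i (G.outcome x σ) ≤ G.cost i (G.outcome x (Function.update σ i τ))

/-- The vertex `x` belongs to player `i`: the next vertex depends on the action of `i` only. -/
def BelongsTo (G : MCRGame N V A) (x : V) (i : Fin N) : Prop :=
  ∀ a a' : ∀ j, A j, a i = a' i → G.next x a = G.next x a'

/-- A game is turn-based if every vertex belongs to some player. -/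
def IsTurnBased (G : MCRGame N V A) : Prop := ∀ x, ∃ i, G.BelongsTo x i

end MCRGame

/-!
For each player `i` consider the zero-sum game in which `i` minimizes the cost of reaching a target
and the coalition of all the others maximizes it. Value iteration (`boundedValue`) starts from `0`
on targets and `⊤` elsewhere and decreases; every finite iterate is the payoff of some finite play,
so the hypothesis bounds the iterates from below and at each vertex the limit `value` is attained,
for the first time at step `valueRank`. As there are finitely many vertices, `value` is a fixed
point of the optimality equations.

Both sides have memoryless optimal strategies. The coalition maximizes `weight + value`, which makes
the potential "payoff so far plus value of the current vertex" nondecreasing until a target is hit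
(`le_cost_of_le_stepCost`). Player `i` follows the iterate at which the value is attained
(`OptimalStep`): the potential never increases, and whenever it stays the same, `valueRank` drops.
Since payoffs and values are bounded below, this cannot go on forever, so a target is reached at
cost at most the value (`exists_target_of_optimalStep`).

In the equilibrium the owner of each vertex plays optimally for herself, and as soon as the play
leaves the resulting path, everybody plays the coalition strategy against the owner of the vertex
where it left. That owner is the deviating player. At that vertex the suffix of the equilibrium path
costs her at most its value, while the deviation costs her at least its value.
-/

namespace MCRGame

variable {N : ℕ} {V : Type u} {A : Fin N → Type v}

/-! ### Costs as partial sums of weights -/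

/-- The payoff `TPᵢ(π₀ ⋯ πₙ)` of the first `n` steps of an infinite sequence. -/
def partialPayoff (G : MCRGame N V A) (i : Fin N) (π : ℕ → V) (n : ℕ) : ℤ :=
  ∑ l ∈ Finset.range n, G.weight i (π l) (π (l + 1))

theorem partialPayoff_succ (G : MCRGame N V A) (i : Fin N) (π : ℕ → V) (n : ℕ) :
    G.partialPayoff i π (n + 1) =
      G.partialPayoff i π n + G.weight i (π n) (π (n + 1)) :=
  Finset.sum_range_succ _ _

theorem partialPayoff_congr (G : MCRGame N V A) (i : Fin N) {π ρ : ℕ → V} {n : ℕ}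
    (h : ∀ l ≤ n, π l = ρ l) : G.partialPayoff i π n = G.partialPayoff i ρ n := by
  refine Finset.sum_congr rfl fun l hl => ?_
  have hl := Finset.mem_range.1 hl
  rw [h l (by omega), h (l + 1) (by omega)]

theorem sumAlong_map_range (w : V → V → ℤ) (π : ℕ → V) (n : ℕ) :
    sumAlong w ((List.range (n + 1)).map π) =
      ∑ l ∈ Finset.range n, w (π l) (π (l + 1)) := by
  induction n generalizing π with
  | zero => simp [sumAlong]
  | succ n ih =>
    have h := ih (fun l => π (l + 1))
    rw [List.range_succ_eq_map] at h ⊢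
    rw [Finset.sum_range_succ', ← h, List.range_succ_eq_map]
    simp only [List.map_cons, List.map_map, sumAlong]
    rw [add_comm]
    rfl

theorem totalPayoff_seqPrefix (G : MCRGame N V A) (i : Fin N) (π : ℕ → V) (n : ℕ) :
    G.totalPayoff i (seqPrefix π n) = G.partialPayoff i π n :=
  sumAlong_map_range _ _ _

theorem isFinitePlay_seqPrefix (G : MCRGame N V A) {π : ℕ → V}
    (h : ∀ n, G.edge (π n) (π (n + 1))) (n : ℕ) : G.IsFinitePlay (seqPrefix π n) := by
  simp only [IsFinitePlay, seqPrefix, List.isChain_iff_getElem]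
  intro k hk
  simpa using h k

theorem cost_eq_partialPayoff (G : MCRGame N V A) (i : Fin N) {π : ℕ → V} {k : ℕ}
    (hk : π k ∈ G.target) (hlt : ∀ l < k, π l ∉ G.target) :
    G.cost i π = (G.partialPayoff i π k : ℤ) := by
  classical
  have h : ∃ n, π n ∈ G.target := ⟨k, hk⟩
  rw [cost, dif_pos h, totalPayoff_seqPrefix]
  have : Nat.find h = k := (Nat.find_eq_iff h).2 ⟨hk, hlt⟩
  rw [this]

theorem cost_eq_top (G : MCRGame N V A) (i : Fin N) {π : ℕ → V}
    (h : ∀ n, π n ∉ G.target) : G.cost i π = ⊤ := by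
  rw [cost, dif_neg (by simpa using h)]

/-! ### Value iteration for one player against all the others -/

/-- The cost for player `i` of moving from `x` by the joint action `a`, if the cost of continuing
is given by `f`. -/
def stepCost (G : MCRGame N V A) (i : Fin N) (f : V → WithTop ℤ) (x : V) (a : ∀ j, A j) :
    WithTop ℤ :=
  (G.weight i x (G.next x a) : WithTop ℤ) + f (G.next x a)

theorem stepCost_mono (G : MCRGame N V A) (i : Fin N) {f g : V → WithTop ℤ} (h : f ≤ g)
    (x : V) (a : ∀ j, A j) : G.stepCost i f x a ≤ G.stepCost i g x a :=
  add_le_add_right (h _) _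

open Classical in
/-- The value for player `i` of the zero-sum game against the coalition of all the others in which
`i` has to reach a target within `n` steps. The map `own` assigns to each vertex the player who
moves there; optimizing over joint actions amounts to optimizing over that player's actions when the
game is turn-based. -/
noncomputable def boundedValue [Fintype (∀ j, A j)] [Nonempty (∀ j, A j)] (G : MCRGame N V A)
    (own : V → Fin N) (i : Fin N) : ℕ → V → WithTop ℤ
  | 0, x => if x ∈ G.target then 0 else ⊤
  | n + 1, x =>
    if x ∈ G.target then 0
    else if own x = i then
      Finset.univ.inf' Finset.univ_nonempty (G.stepCost i (boundedValue G own i n) x)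
    else Finset.univ.sup' Finset.univ_nonempty (G.stepCost i (boundedValue G own i n) x)

section BoundedValue

variable [Fintype (∀ j, A j)] [Nonempty (∀ j, A j)] {G : MCRGame N V A} {own : V → Fin N}
  {i : Fin N}

theorem boundedValue_of_mem {x : V} (hx : x ∈ G.target) (n : ℕ) :
    G.boundedValue own i n x = 0 := by
  cases n <;> simp [boundedValue, hx]

theorem boundedValue_zero_of_notMem {x : V} (hx : x ∉ G.target) :
    G.boundedValue own i 0 x = ⊤ := by
  simp [boundedValue, hx]

theorem boundedValue_succ_le {x : V} (hx : x ∉ G.target) (ho : own x = i) (n : ℕ)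
    (a : ∀ j, A j) :
    G.boundedValue own i (n + 1) x ≤ G.stepCost i (G.boundedValue own i n) x a := by
  rw [boundedValue, if_neg hx, if_pos ho]
  exact Finset.inf'_le _ (Finset.mem_univ a)

theorem le_boundedValue_succ {x : V} (hx : x ∉ G.target) (ho : own x ≠ i) (n : ℕ)
    (a : ∀ j, A j) :
    G.stepCost i (G.boundedValue own i n) x a ≤ G.boundedValue own i (n + 1) x := by
  rw [boundedValue, if_neg hx, if_neg ho]
  exact Finset.le_sup' _ (Finset.mem_univ a)

theorem exists_boundedValue_succ_eq {x : V} (hx : x ∉ G.target) (n : ℕ) :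
    ∃ a, G.boundedValue own i (n + 1) x = G.stepCost i (G.boundedValue own i n) x a := by
  rw [boundedValue, if_neg hx]
  split_ifs
  · obtain ⟨a, -, h⟩ := Finset.exists_mem_eq_inf' Finset.univ_nonempty
      (G.stepCost i (G.boundedValue own i n) x)
    exact ⟨a, h⟩
  · obtain ⟨a, -, h⟩ := Finset.exists_mem_eq_sup' Finset.univ_nonempty
      (G.stepCost i (G.boundedValue own i n) x)
    exact ⟨a, h⟩

variable (G own i) in
theorem boundedValue_antitone : Antitone (G.boundedValue own i) := by
  refine antitone_nat_of_succ_le fun n => ?_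
  induction n with
  | zero =>
    intro x
    by_cases hx : x ∈ G.target
    · simp [boundedValue_of_mem hx]
    · simp [boundedValue_zero_of_notMem hx]
  | succ n ih =>
    intro x
    by_cases hx : x ∈ G.target
    · simp [boundedValue_of_mem hx]
    by_cases ho : own x = i
    · obtain ⟨a, ha⟩ := exists_boundedValue_succ_eq (own := own) (i := i) hx n
      rw [ha]
      exact (boundedValue_succ_le hx ho _ a).trans (G.stepCost_mono i ih x a)
    · obtain ⟨a, ha⟩ := exists_boundedValue_succ_eq (own := own) (i := i) hx (n + 1)
      rw [ha]
      exact (G.stepCost_mono i ih x a).trans (le_boundedValue_succ hx ho _ a)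

/-- A finite bounded value is the payoff of a finite play, along which both sides play optimally. -/
theorem exists_sumAlong_eq_of_boundedValue_eq {n : ℕ} {x : V} {c : ℤ}
    (h : G.boundedValue own i n x = c) :
    ∃ l : List V, (x :: l).IsChain G.edge ∧ sumAlong (G.weight i) (x :: l) = c := by
  induction n generalizing x c with
  | zero =>
    by_cases hx : x ∈ G.target
    · rw [boundedValue_of_mem hx] at h
      exact ⟨[], by simp, by simpa [sumAlong] using WithTop.coe_injective h⟩
    · simp [boundedValue_zero_of_notMem hx] at h
  | succ n ih =>
    by_cases hx : x ∈ G.target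
    · rw [boundedValue_of_mem hx] at h
      exact ⟨[], by simp, by simpa [sumAlong] using WithTop.coe_injective h⟩
    obtain ⟨a, ha⟩ := exists_boundedValue_succ_eq (own := own) (i := i) hx n
    rw [h, stepCost] at ha
    cases hy : G.boundedValue own i n (G.next x a) with
    | top => simp [hy] at ha
    | coe d =>
      obtain ⟨l, hl, hs⟩ := ih hy
      refine ⟨G.next x a :: l, List.isChain_cons_cons.2 ⟨G.next_edge x a, hl⟩, ?_⟩
      rw [hy] at ha
      rw [sumAlong, hs]
      exact_mod_cast ha.symm

theorem neg_le_boundedValue {b : ℕ}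
    (hb : ∀ ρ : NonemptySeq V, G.IsFinitePlay ρ → -(b : ℤ) ≤ G.totalPayoff i ρ) (n : ℕ) (x : V) :
    ((-(b : ℤ) : ℤ) : WithTop ℤ) ≤ G.boundedValue own i n x := by
  cases h : G.boundedValue own i n x with
  | top => exact le_top
  | coe c =>
    obtain ⟨l, hl, hs⟩ := exists_sumAlong_eq_of_boundedValue_eq h
    rw [← hs]
    exact WithTop.coe_le_coe.2 (hb ⟨x :: l, by simp⟩ hl)

theorem exists_boundedValue_le {b : ℕ}
    (hb : ∀ ρ : NonemptySeq V, G.IsFinitePlay ρ → -(b : ℤ) ≤ G.totalPayoff i ρ) (x : V) :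
    ∃ n, ∀ m, G.boundedValue own i n x ≤ G.boundedValue own i m x := by
  by_cases h : ∃ c : ℤ, ∃ n, G.boundedValue own i n x = c
  · obtain ⟨c, ⟨n, hn⟩, hmin⟩ := Int.exists_least_of_bdd
      (P := fun c => ∃ n, G.boundedValue own i n x = c)
      ⟨-(b : ℤ), fun z ⟨n, hn⟩ =>
        WithTop.coe_le_coe.1 (hn ▸ neg_le_boundedValue hb n x)⟩ h
    refine ⟨n, fun m => ?_⟩
    cases hm : G.boundedValue own i m x with
    | top => exact le_top
    | coe d => exact hn ▸ WithTop.coe_le_coe.2 (hmin d ⟨m, hm⟩)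
  · refine ⟨0, fun m => ?_⟩
    cases hm : G.boundedValue own i m x with
    | top => exact le_top
    | coe d => exact absurd ⟨d, m, hm⟩ h

end BoundedValue

/-! ### The value and optimal moves -/

section Value

variable [Fintype (∀ j, A j)] [Nonempty (∀ j, A j)]

open Classical in
/-- The first step at which value iteration attains its minimum at `x`; it is `0` by convention if
there is no minimum. -/
noncomputable def valueRank (G : MCRGame N V A) (own : V → Fin N) (i : Fin N) (x : V) : ℕ :=
  if h : ∃ n, ∀ m, G.boundedValue own i n x ≤ G.boundedValue own i m x then Nat.find h else 0

/-- The value for player `i` of the zero-sum reachability game against all the others, provided that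
value iteration attains its minimum at every vertex. -/
noncomputable def value (G : MCRGame N V A) (own : V → Fin N) (i : Fin N) (x : V) : WithTop ℤ :=
  G.boundedValue own i (G.valueRank own i x) x

/-- The move from `x` to `y` is good for player `i`: if `x` has finite value, the payoff of
the move plus the value of `y` is smaller than the value of `x`, or at most equal to it with `y` of
smaller rank. -/
def OptimalStep (G : MCRGame N V A) (own : V → Fin N) (i : Fin N) (x y : V) : Prop :=
  G.value own i x = ⊤ ∨
    (G.weight i x y : WithTop ℤ) + G.value own i y < G.value own i x ∨
    ((G.weight i x y : WithTop ℤ) + G.value own i y ≤ G.value own i x ∧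
      G.valueRank own i y < G.valueRank own i x)

variable {G : MCRGame N V A} {own : V → Fin N} {i : Fin N}

theorem value_of_mem {x : V} (hx : x ∈ G.target) : G.value own i x = 0 :=
  boundedValue_of_mem hx _

section Bounded

variable {b : ℕ} (hb : ∀ ρ : NonemptySeq V, G.IsFinitePlay ρ → -(b : ℤ) ≤ G.totalPayoff i ρ)
include hb

theorem value_le_boundedValue (n : ℕ) (x : V) :
    G.value own i x ≤ G.boundedValue own i n x := by
  classical
  have h := exists_boundedValue_le (own := own) hb x
  rw [value, valueRank, dif_pos h]
  exact Nat.find_spec h n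

theorem valueRank_le {n : ℕ} {x : V} (h : G.boundedValue own i n x ≤ G.value own i x) :
    G.valueRank own i x ≤ n := by
  classical
  have h' := exists_boundedValue_le (own := own) hb x
  rw [valueRank, dif_pos h']
  exact Nat.find_min' h' fun m => h.trans (value_le_boundedValue hb m x)

theorem exists_boundedValue_eq_value [Finite V] :
    ∃ M, ∀ n ≥ M, G.boundedValue own i n = G.value own i := by
  obtain ⟨M, hM⟩ := (Set.finite_range (G.valueRank own i)).bddAbove
  refine ⟨M, fun n hn => funext fun x => le_antisymm ?_ (value_le_boundedValue hb n x)⟩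
  exact boundedValue_antitone G own i ((hM (Set.mem_range_self x)).trans hn) x

theorem value_le_stepCost [Finite V] {x : V} (hx : x ∉ G.target) (ho : own x = i)
    (a : ∀ j, A j) : G.value own i x ≤ G.stepCost i (G.value own i) x a := by
  obtain ⟨M, hM⟩ := exists_boundedValue_eq_value (own := own) hb
  have h := boundedValue_succ_le hx ho M a
  rwa [hM _ (by omega), hM _ le_rfl] at h

theorem exists_value_le_stepCost [Finite V] {x : V} (hx : x ∉ G.target) :
    ∃ a, G.value own i x ≤ G.stepCost i (G.value own i) x a := by
  obtain ⟨M, hM⟩ := exists_boundedValue_eq_value (own := own) hb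
  obtain ⟨a, ha⟩ := exists_boundedValue_succ_eq (own := own) (i := i) hx M
  rw [hM _ (by omega), hM _ le_rfl] at ha
  exact ⟨a, ha.le⟩

theorem optimalStep_of_stepCost_le {x : V} {a : ∀ j, A j} {n : ℕ}
    (hn : G.valueRank own i x = n + 1)
    (h : G.stepCost i (G.boundedValue own i n) x a ≤ G.value own i x) :
    G.OptimalStep own i x (G.next x a) := by
  have hle := (G.stepCost_mono i (fun y => value_le_boundedValue hb n y) x a).trans h
  by_cases htop : G.value own i x = ⊤
  · exact Or.inl htop
  rcases hle.lt_or_eq with hlt | heq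
  · exact Or.inr (Or.inl hlt)
  refine Or.inr (Or.inr ⟨hle, ?_⟩)
  -- The value is attained at `x`, so iterate `n` already attains the value of the successor.
  rw [hn, Nat.lt_succ_iff]
  refine valueRank_le hb ?_
  rw [← heq] at h
  exact (WithTop.add_le_add_iff_left WithTop.coe_ne_top).1 h

theorem exists_optimalStep {x : V} (hx : x ∉ G.target) :
    ∃ a, G.OptimalStep own i x (G.next x a) := by
  cases hn : G.valueRank own i x with
  | zero =>
    exact ⟨Classical.arbitrary _, Or.inl (by rw [value, hn, boundedValue_zero_of_notMem hx])⟩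
  | succ n =>
    obtain ⟨a, ha⟩ := exists_boundedValue_succ_eq (own := own) (i := i) hx n
    exact ⟨a, optimalStep_of_stepCost_le hb hn (by rw [value, hn, ha])⟩

theorem optimalStep_of_ne {x : V} (hx : x ∉ G.target) (ho : own x ≠ i) (a : ∀ j, A j) :
    G.OptimalStep own i x (G.next x a) := by
  cases hn : G.valueRank own i x with
  | zero => exact Or.inl (by rw [value, hn, boundedValue_zero_of_notMem hx])
  | succ n =>
    refine optimalStep_of_stepCost_le hb hn ?_
    rw [value, hn]
    exact le_boundedValue_succ hx ho n a

/-- A play that follows good moves of player `i` reaches a target, at a cost of at most the value: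
the pair of "payoff so far plus value" and rank decreases lexicographically, and its first component
is bounded below. -/
theorem exists_target_of_optimalStep {π : ℕ → V} (hedge : ∀ n, G.edge (π n) (π (n + 1)))
    (hopt : ∀ n, π n ∉ G.target → G.OptimalStep own i (π n) (π (n + 1)))
    {n : ℕ} {c : ℤ} (hc : G.value own i (π n) = c) :
    ∃ k ≥ n, π k ∈ G.target ∧ (∀ l, n ≤ l → l < k → π l ∉ G.target) ∧
      G.partialPayoff i π k ≤ G.partialPayoff i π n + c := by
  have hlow : ∀ m (d : ℤ), G.value own i (π m) = d → -(2 * b : ℤ) ≤ G.partialPayoff i π m + d := by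
    intro m d hd
    have h1 : -(b : ℤ) ≤ d :=
      WithTop.coe_le_coe.1 (hd ▸ neg_le_boundedValue hb (G.valueRank own i (π m)) (π m))
    have h2 := hb _ (G.isFinitePlay_seqPrefix hedge m)
    rw [totalPayoff_seqPrefix] at h2
    omega
  suffices H : ∀ s r n (c : ℤ), G.value own i (π n) = c →
      (G.partialPayoff i π n + c + 2 * b).toNat = s → G.valueRank own i (π n) = r →
      ∃ k ≥ n, π k ∈ G.target ∧ (∀ l, n ≤ l → l < k → π l ∉ G.target) ∧
        G.partialPayoff i π k ≤ G.partialPayoff i π n + c from H _ _ n c hc rfl rfl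
  intro s
  induction s using Nat.strong_induction_on with
  | _ s ihs =>
  intro r
  induction r using Nat.strong_induction_on with
  | _ r ihr =>
  intro n c hc hs hr
  by_cases hT : π n ∈ G.target
  · rw [value_of_mem hT] at hc
    have : (0 : ℤ) = c := WithTop.coe_injective hc
    exact ⟨n, le_rfl, hT, fun l h1 h2 => absurd h2 (by omega), by omega⟩
  have hstep := hopt n hT
  rw [OptimalStep, hc] at hstep
  cases hd : G.value own i (π (n + 1)) with
  | top => simp [hd] at hstep
  | coe d =>
    have hstep' : G.weight i (π n) (π (n + 1)) + d < c ∨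
        (G.weight i (π n) (π (n + 1)) + d ≤ c ∧
          G.valueRank own i (π (n + 1)) < G.valueRank own i (π n)) := by
      rw [hd] at hstep
      simp only [WithTop.coe_ne_top, false_or] at hstep
      exact_mod_cast hstep
    have h1 := hlow n c hc
    have h2 := hlow (n + 1) d hd
    have hsucc := G.partialPayoff_succ i π n
    have key : ∃ k ≥ n + 1, π k ∈ G.target ∧ (∀ l, n + 1 ≤ l → l < k → π l ∉ G.target) ∧
        G.partialPayoff i π k ≤ G.partialPayoff i π (n + 1) + d := by
      by_cases hlt : G.weight i (π n) (π (n + 1)) + d < c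
      · exact ihs _ (by omega) _ (n + 1) d hd rfl rfl
      · exact ihr _ (by omega) (n + 1) d hd (by omega) rfl
    obtain ⟨k, hk, hkT, hbefore, hle⟩ := key
    refine ⟨k, by omega, hkT, fun l hl hlk => ?_, by omega⟩
    rcases hl.eq_or_lt with rfl | hl
    · exact hT
    · exact hbefore l hl hlk

theorem cost_le_of_optimalStep {π : ℕ → V} (hedge : ∀ n, G.edge (π n) (π (n + 1)))
    (hopt : ∀ n, π n ∉ G.target → G.OptimalStep own i (π n) (π (n + 1)))
    {n : ℕ} (hn : ∀ l < n, π l ∉ G.target) :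
    G.cost i π ≤ (G.partialPayoff i π n : WithTop ℤ) + G.value own i (π n) := by
  cases hc : G.value own i (π n) with
  | top => simp
  | coe c =>
    obtain ⟨k, -, hkT, hbefore, hle⟩ := exists_target_of_optimalStep hb hedge hopt hc
    rw [G.cost_eq_partialPayoff i hkT fun l hl =>
      (lt_or_ge l n).elim (hn l) fun h => hbefore l h hl]
    exact_mod_cast hle

end Bounded

theorem le_cost_of_le_stepCost {π : ℕ → V} {n : ℕ} (hn : ∀ l < n, π l ∉ G.target)
    (hstep : ∀ m ≥ n, π m ∉ G.target → G.value own i (π m) ≤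
      (G.weight i (π m) (π (m + 1)) : WithTop ℤ) + G.value own i (π (m + 1))) :
    (G.partialPayoff i π n : WithTop ℤ) + G.value own i (π n) ≤ G.cost i π := by
  classical
  by_cases h : ∃ k, π k ∈ G.target
  · have hT := Nat.find_spec h
    have hmin : ∀ l < Nat.find h, π l ∉ G.target := fun l hl => Nat.find_min h hl
    set k := Nat.find h
    have hnk : n ≤ k := not_lt.1 fun hlt => hn k hlt hT
    have hmono : ∀ m, n ≤ m → m ≤ k →
        (G.partialPayoff i π n : WithTop ℤ) + G.value own i (π n) ≤
          (G.partialPayoff i π m : WithTop ℤ) + G.value own i (π m) := by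
      intro m hm
      induction m, hm using Nat.le_induction with
      | base => exact fun _ => le_rfl
      | succ m hm ih =>
        intro hmk
        refine (ih (by omega)).trans ?_
        refine (add_le_add_right (hstep m hm (hmin m (by omega))) _).trans_eq ?_
        rw [partialPayoff_succ, WithTop.coe_add, add_assoc]
    have := hmono k hnk le_rfl
    rw [G.cost_eq_partialPayoff i hT hmin]
    rwa [value_of_mem hT, add_zero] at this
  · rw [G.cost_eq_top i (by simpa using h)]
    exact le_top

end Value

/-! ### Punishing the first deviation from a path -/

open Classical in
/-- The strategies that follow the memoryless joint action `act` as long as the history is a prefix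
of `ρ`, and from the first deviation on, say at index `m`, follow the memoryless joint action
`pun j`, where `j` is the owner of `ρ (m - 1)`. (A deviation at index `0` cannot occur in plays
that start in `ρ 0`.) -/
noncomputable def punishingProfile (own : V → Fin N) (ρ : ℕ → V) (act : V → ∀ j, A j)
    (pun : Fin N → V → ∀ j, A j) : Profile V A := fun k h =>
  if hd : ∃ m, ∃ y ∈ h.1[m]?, y ≠ ρ m then pun (own (ρ (Nat.find hd - 1))) h.last k
  else act h.last k

section Punishing

variable {own : V → Fin N} {ρ π : ℕ → V} {act : V → ∀ j, A j} {pun : Fin N → V → ∀ j, A j}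

theorem seqPrefix_last (π : ℕ → V) (n : ℕ) : (seqPrefix π n).last = π n := by
  simp [seqPrefix, NonemptySeq.last]

theorem exists_mem_getElem?_seqPrefix_iff {n m : ℕ} {p : V → Prop} :
    (∃ y ∈ (seqPrefix π n).1[m]?, p y) ↔ m ≤ n ∧ p (π m) := by
  rcases le_or_gt m n with h | h <;> simp [seqPrefix, h]

theorem punishingProfile_of_agree {n : ℕ} (h : ∀ l ≤ n, π l = ρ l) (k : Fin N) :
    punishingProfile own ρ act pun k (seqPrefix π n) = act (π n) k := by
  rw [punishingProfile, dif_neg, seqPrefix_last]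
  rintro ⟨m, hm⟩
  obtain ⟨hmn, hne⟩ := exists_mem_getElem?_seqPrefix_iff.1 hm
  exact hne (h m hmn)

theorem punishingProfile_of_deviate {n m : ℕ} (hne : π (m + 1) ≠ ρ (m + 1))
    (h : ∀ l ≤ m, π l = ρ l) (hmn : m + 1 ≤ n) (k : Fin N) :
    punishingProfile own ρ act pun k (seqPrefix π n) = pun (own (ρ m)) (π n) k := by
  classical
  have hd : ∃ m, ∃ y ∈ (seqPrefix π n).1[m]?, y ≠ ρ m :=
    ⟨m + 1, exists_mem_getElem?_seqPrefix_iff.2 ⟨hmn, hne⟩⟩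
  have hfind : Nat.find hd = m + 1 := by
    refine (Nat.find_eq_iff hd).2
      ⟨exists_mem_getElem?_seqPrefix_iff.2 ⟨hmn, hne⟩, fun l hl hl' => ?_⟩
    exact (exists_mem_getElem?_seqPrefix_iff.1 hl').2 (h l (by omega))
  rw [punishingProfile, dif_pos hd, seqPrefix_last, hfind, Nat.add_sub_cancel]

end Punishing

theorem outcome_edge (G : MCRGame N V A) (x : V) (σ : Profile V A) (n : ℕ) :
    G.edge (G.outcome x σ n) (G.outcome x σ (n + 1)) := by
  rw [outcome_succ]
  exact G.next_edge _ _

/-- The outcome of the punishing profile is the path it protects. -/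
theorem outcome_punishingProfile (G : MCRGame N V A) {own : V → Fin N} {ρ : ℕ → V}
    {act : V → ∀ j, A j} {pun : Fin N → V → ∀ j, A j}
    (hρ : ∀ n, ρ (n + 1) = G.next (ρ n) (act (ρ n))) :
    G.outcome (ρ 0) (punishingProfile own ρ act pun) = ρ := by
  funext n
  induction n using Nat.strong_induction_on with
  | _ n ih =>
  cases n with
  | zero => exact G.outcome_zero _ _
  | succ n =>
    rw [outcome_succ, hρ]
    simp only [punishingProfile_of_agree fun l hl => ih l (Nat.lt_succ_of_le hl)]
    rw [ih n n.lt_succ_self]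

end MCRGame

open MCRGame in
theorem theorem1 {N : ℕ} {V : Type u} {A : Fin N → Type v} [Finite V]
    [∀ i, Finite (A i)] [∀ i, Nonempty (A i)] (G : MCRGame N V A)
    (hturn : G.IsTurnBased)
    (hbound : ∀ i : Fin N, ∃ b : ℕ, ∀ ρ : NonemptySeq V,
      G.IsFinitePlay ρ → -(b : ℤ) ≤ G.totalPayoff i ρ) :
    ∀ x : V, ∃ σ : MCRGame.Profile V A, G.IsNashEquilibrium x σ := by
  intro x
  have := Fintype.ofFinite (∀ j, A j)
  choose own hown using hturn
  choose b hb using hbound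
  have hact : ∀ y, ∃ a, y ∉ G.target → G.OptimalStep own (own y) y (G.next y a) := fun y => by
    by_cases hy : y ∈ G.target
    · exact ⟨Classical.arbitrary _, fun h => absurd hy h⟩
    · exact (exists_optimalStep (hb _) hy).imp fun _ h _ => h
  have hpun : ∀ j y, ∃ a, y ∉ G.target →
      G.value own j y ≤ G.stepCost j (G.value own j) y a := fun j y => by
    by_cases hy : y ∈ G.target
    · exact ⟨Classical.arbitrary _, fun h => absurd hy h⟩
    · exact (exists_value_le_stepCost (hb j) hy).imp fun _ h _ => h
  choose act hact using hact
  choose pun hpun using hpun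
  let ρ : ℕ → V := fun n => (fun y => G.next y (act y))^[n] x
  have hρ : ∀ n, ρ (n + 1) = G.next (ρ n) (act (ρ n)) := fun n =>
    Function.iterate_succ_apply' _ _ _
  have hout := G.outcome_punishingProfile (own := own) (pun := pun) hρ
  refine ⟨punishingProfile own ρ act pun, fun i τ => ?_⟩
  set σ := punishingProfile own ρ act pun with hσ
  rw [show G.outcome x σ = ρ from hout]
  set π := G.outcome x (Function.update σ i τ) with hπ
  have hπs : ∀ n, π (n + 1) =
      G.next (π n) (fun k => Function.update σ i τ k (seqPrefix π n)) :=
    G.outcome_succ x _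
  by_cases hdev : ∃ m, π m ≠ ρ m
  swap
  · push Not at hdev
    rw [funext hdev]
  classical
  obtain ⟨m, hm⟩ : ∃ m, Nat.find hdev = m + 1 := Nat.exists_eq_succ_of_ne_zero fun h0 => by
    have := Nat.find_spec hdev
    rw [h0] at this
    exact this (G.outcome_zero x _)
  have hne : π (m + 1) ≠ ρ (m + 1) := hm ▸ Nat.find_spec hdev
  have hagree : ∀ l ≤ m, π l = ρ l := fun l hl =>
    not_not.1 (Nat.find_min hdev (by omega))
  -- Only the owner of `ρ m` can leave the path there.
  have howner : own (ρ m) = i := by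
    by_contra hi
    refine hne ?_
    rw [hπs, hρ, hagree m le_rfl]
    refine hown (ρ m) _ _ ?_
    rw [Function.update_of_ne hi, hσ, punishingProfile_of_agree hagree, hagree m le_rfl]
  by_cases hT : ∃ l ≤ m, ρ l ∈ G.target
  · -- The play is already over when player `i` deviates.
    have hT' : ∃ l, ρ l ∈ G.target := hT.imp fun _ h => h.2
    have hle : Nat.find hT' ≤ m := by
      obtain ⟨l, hl, h⟩ := hT
      exact (Nat.find_min' hT' h).trans hl
    have hmin : ∀ l < Nat.find hT', ρ l ∉ G.target := fun l hl => Nat.find_min hT' hl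
    rw [G.cost_eq_partialPayoff i (Nat.find_spec hT') hmin,
      G.cost_eq_partialPayoff i (π := π) (k := Nat.find hT')
        (by rw [hagree _ hle]; exact Nat.find_spec hT')
        (fun l hl => by rw [hagree l (by omega)]; exact hmin l hl),
      G.partialPayoff_congr i fun l hl => hagree l (hl.trans hle)]
  push Not at hT
  calc G.cost i ρ
      ≤ (G.partialPayoff i ρ m : WithTop ℤ) + G.value own i (ρ m) := by
        refine cost_le_of_optimalStep (hb i) (fun n => hρ n ▸ G.next_edge _ _) (fun n hn => ?_)
          fun l hl => hT l hl.le
        rw [hρ]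
        by_cases ho : own (ρ n) = i
        · exact ho ▸ hact _ hn
        · exact optimalStep_of_ne (hb i) hn ho _
    _ = (G.partialPayoff i π m : WithTop ℤ) + G.value own i (π m) := by
        rw [G.partialPayoff_congr i hagree, hagree m le_rfl]
    _ ≤ G.cost i π := by
        refine le_cost_of_le_stepCost (fun l hl => hagree l hl.le ▸ hT l hl.le)
          fun n hn hnT => ?_
        by_cases ho : own (π n) = i
        · rw [hπs]
          exact value_le_stepCost (hb i) hnT ho _
        · -- The owner of `π n` is not `i`, so the deviation lies in the past and is being punished.
          have hmn : m + 1 ≤ n := by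
            rcases hn.eq_or_lt with rfl | h
            · exact absurd (by rw [hagree _ le_rfl, howner]) ho
            · exact h
          have hnext : π (n + 1) = G.next (π n) (pun i (π n)) := by
            rw [hπs]
            refine hown (π n) _ _ ?_
            rw [Function.update_of_ne ho, hσ, punishingProfile_of_deviate hne hagree hmn, howner]
          rw [hnext]
          exact hpun i (π n) hnT
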